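/- Let $x_0,\varphi\in\mathbb{R}^n$, $a_1,\dots,a_m\in\mathbb{R}^n$, $b\in\mathbb{R}^m$ and $\lambda>0$. RobustPhaseMax is the linear program $$\max_{x\in\mathbb{R}^n,\ e\in\mathbb{R}^m}\ \langle\varphi,x\rangle-\lambda\sum_{i=1}^m e_i\quad\text{subject to}\quad -b_i-e_i\le\langle a_i,x\rangle\le b_i+e_i,\quad e_i\ge 0,\quad i=1,\dots,m.$$ **Theorem.** For every real $M\ge 7$ there exist constants $c,\gamma,\delta>0$, depending only on $M$, such that the following holds for all $n,m$. Let $x_0\in\mathbb{R}^n$, let $\varphi\in\mathbb{R}^n$ satisfy $\|\varphi-x_0\|_2<0.5\,\|x_0\|_2$, and let $a_1,\dots,a_m\sim\mathcal{N}(0,I_{n\times n})$ be independent. If $m\ge cn$ and $\lambda\in\left[\frac{7}{m}\|x_0\|_2,\frac{M}{m}\|x_0\|_2\right]$, then with probability at least $1-9me^{-\gamma m}$ the following holds simultaneously for all $\eta\in\mathbb{R}^m$ with $|\{i:\eta_i\ne 0\}|\le\delta m$: the pair $(x,e)=(x_0,-\eta^-)$, where $\eta^-_i=\min(\eta_i,0)$,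 is the unique maximizer of RobustPhaseMax with $b_i=|\langle a_i,x_0\rangle|+\eta_i$, $i=1,\dots,m$. -/

import Mathlib

open MeasureTheory ProbabilityTheory
open scoped RealInnerProductSpace

/-- The objective `⟨φ, x⟩ - lam * ⟨1, e⟩` of RobustPhaseMax at the point `(x, e)`. -/
noncomputable def rpmObjective {n m : ℕ} (φ : EuclideanSpace ℝ (Fin n)) (lam : ℝ)
    (p : EuclideanSpace ℝ (Fin n) × (Fin m → ℝ)) : ℝ :=
  ⟪φ, p.1⟫ - lam * ∑ i, p.2 i

/-- The feasible set of RobustPhaseMax with measurement vectors `a` and data `b`: the pairs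
`(x, e)` with `-b i - e i ≤ ⟨a i, x⟩ ≤ b i + e i` and `0 ≤ e i` for every `i`. -/
def rpmFeasible {n m : ℕ} (a : Fin m → EuclideanSpace ℝ (Fin n)) (b : Fin m → ℝ) :
    Set (EuclideanSpace ℝ (Fin n) × (Fin m → ℝ)) :=
  {p | ∀ i, -b i - p.2 i ≤ ⟪a i, p.1⟫ ∧ ⟪a i, p.1⟫ ≤ b i + p.2 i ∧ 0 ≤ p.2 i}

/-- `p` is the unique maximizer of RobustPhaseMax: it is feasible, it maximizes the objective
over the feasible set, and every feasible maximizer equals `p`. -/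
def IsUniqueRpmMaximizer {n m : ℕ} (φ : EuclideanSpace ℝ (Fin n)) (lam : ℝ)
    (a : Fin m → EuclideanSpace ℝ (Fin n)) (b : Fin m → ℝ)
    (p : EuclideanSpace ℝ (Fin n) × (Fin m → ℝ)) : Prop :=
  p ∈ rpmFeasible a b ∧ IsMaxOn (rpmObjective φ lam) (rpmFeasible a b) p ∧
    ∀ q ∈ rpmFeasible a b, IsMaxOn (rpmObjective φ lam) (rpmFeasible a b) q → q = p

/-! Write h = x - x₀, u = x₀/‖x₀‖, S = {i : η_i ≠ 0}. Feasibility forces 2(e_i + η_i⁻) ≥ Y_i(h) for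
i ∉ S, where Y_i(h) = |⟨a_i,h⟩| + sgn⟨a_i,x₀⟩⟨a_i,h⟩ is `orientedPart`; for i ∈ S it still gives
2(e_i + η_i⁻) ≥ Y_i(h) - 4|⟨a_i,h⟩|. Hence (x₀, -η⁻) is the unique maximizer once 2⟨φ,h⟩ < λ(∑
Y_i(h) - 4 ∑_{i∈S} |⟨a_i,h⟩|) for all h ≠ 0 (`isUniqueRpmMaximizer_of_forall_direction`).

For unit h the mean of Y_i(h) is κ(1 + ⟨u,h⟩) with κ = E|g| ∈ [1/4, 1]. Chernoff bounds control ∑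
Y_i and ∑ ⟨a_i,h⟩² at the points of a net of the sphere (`exists_event_bounds_on_finset`). On that
event everything else is deterministic: the quadratic bound controls the operator norm of (a_i),
which pays both for leaving the net and for any small set S (`le_sum_orientedPart_of_net`). A single
event therefore serves all η. `two_mul_inner_lt_of_sphere` compares the result with the objective.
-/

section Gaussian

/-! ### Gaussian moments and the mean of `orientedPart`. -/

/-- The sign of a real number, with value `1` at `0`. -/
noncomputable def unitSign (t : ℝ) : ℝ := if 0 ≤ t then 1 else -1

lemma abs_unitSign (t : ℝ) : |unitSign t| = 1 := by
  unfold unitSign; split_ifs <;> simp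

lemma unitSign_mul_self (t : ℝ) : unitSign t * t = |t| := by
  unfold unitSign
  split_ifs with h
  · rw [one_mul, abs_of_nonneg h]
  · rw [abs_of_neg (not_le.1 h), neg_one_mul]

lemma abs_unitSign_mul (s t : ℝ) : |unitSign s * t| = |t| := by
  rw [abs_mul, abs_unitSign, one_mul]

@[fun_prop]
lemma measurable_unitSign : Measurable unitSign :=
  Measurable.ite measurableSet_Ici measurable_const measurable_const

variable {E : Type*} [NormedAddCommGroup E] [InnerProductSpace ℝ E]

/-- Twice the positive part of `⟪x, h⟫`, with the orientation for which `⟪x, u⟫` is nonnegative. -/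
noncomputable def orientedPart (u h x : E) : ℝ := |⟪x, h⟫| + unitSign ⟪x, u⟫ * ⟪x, h⟫

@[fun_prop]
lemma measurable_orientedPart [MeasurableSpace E] [BorelSpace E] (u h : E) : Measurable (orientedPart u h) := by
  unfold orientedPart; fun_prop

lemma orientedPart_nonneg (u h x : E) : 0 ≤ orientedPart u h x := by
  have := neg_abs_le (unitSign ⟪x, u⟫ * ⟪x, h⟫)
  rw [abs_unitSign_mul] at this
  unfold orientedPart
  linarith

lemma orientedPart_le (u h x : E) : orientedPart u h x ≤ 2 * |⟪x, h⟫| := by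
  have := le_abs_self (unitSign ⟪x, u⟫ * ⟪x, h⟫)
  rw [abs_unitSign_mul] at this
  unfold orientedPart
  linarith

variable [FiniteDimensional ℝ E] [MeasurableSpace E] [BorelSpace E]

lemma map_inner_stdGaussian {h : E} (hh : ‖h‖ = 1) :
    (stdGaussian E).map (fun x => ⟪h, x⟫) = gaussianReal 0 1 := by
  have := IsGaussian.map_eq_gaussianReal (μ := stdGaussian E) (innerSL ℝ h)
  rw [integral_strongDual_stdGaussian, variance_dual_stdGaussian, innerSL_apply_norm, hh] at this
  simpa using this

lemma integral_comp_inner_stdGaussian {h : E} (hh : ‖h‖ = 1) {f : ℝ → ℝ} (hf : Measurable f) :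
    ∫ x, f ⟪x, h⟫ ∂stdGaussian E = ∫ t, f t ∂gaussianReal 0 1 := by
  rw [← map_inner_stdGaussian hh, integral_map (by fun_prop) hf.aestronglyMeasurable]
  simp_rw [real_inner_comm]

lemma integrable_comp_inner_stdGaussian {h : E} (hh : ‖h‖ = 1) {f : ℝ → ℝ}
    (hf : Integrable f (gaussianReal 0 1)) :
    Integrable (fun x => f ⟪x, h⟫) (stdGaussian E) := by
  rw [← map_inner_stdGaussian hh] at hf
  have := hf.comp_measurable (by fun_prop)
  simpa only [Function.comp_def, real_inner_comm] using this

lemma integrable_inner_stdGaussian (h : E) : Integrable (fun x => ⟪x, h⟫) (stdGaussian E) :=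
  IsGaussian.integrable_id.inner_const h

/-- The mean absolute value of a standard Gaussian variable. -/
noncomputable def gaussianAbsMean : ℝ := ∫ t, |t| ∂gaussianReal 0 1

lemma integrable_abs_gaussianReal : Integrable (fun t : ℝ => |t|) (gaussianReal 0 1) :=
  (IsGaussian.integrable_id (μ := gaussianReal 0 1)).abs

lemma integrable_sq_gaussianReal : Integrable (fun t : ℝ => t ^ 2) (gaussianReal 0 1) :=
  (IsGaussian.memLp_two_id (μ := gaussianReal 0 1)).integrable_sq

lemma integral_sq_gaussianReal : ∫ t, t ^ 2 ∂gaussianReal 0 1 = 1 := by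
  have := variance_fun_id_gaussianReal (μ := 0) (v := 1)
  rw [variance_eq_integral (by fun_prop)] at this
  simpa using this

lemma gaussianAbsMean_le_one : gaussianAbsMean ≤ 1 := by
  have h : gaussianAbsMean ≤ ∫ t, (1 + t ^ 2) / 2 ∂gaussianReal 0 1 := by
    refine integral_mono integrable_abs_gaussianReal
      (((integrable_const 1).add integrable_sq_gaussianReal).div_const 2) fun t => ?_
    simp only
    nlinarith [sq_nonneg (|t| - 1), sq_abs t]
  rw [integral_div, integral_add (integrable_const 1) integrable_sq_gaussianReal,
    integral_sq_gaussianReal] at h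
  simpa using h

lemma integral_cos_gaussianReal : ∫ t, Real.cos t ∂gaussianReal 0 1 = Real.exp (-1 / 2) := by
  have h := charFun_gaussianReal (μ := 0) (v := 1) 1
  rw [charFun_apply_real] at h
  have h2 := congrArg Complex.re h
  rw [← RCLike.re_eq_complex_re, ← integral_re] at h2
  · simp only [RCLike.re_eq_complex_re] at h2
    have e1 : ∀ x : ℝ, (Complex.exp ((1 : ℝ) * x * Complex.I)).re = Real.cos x := by
      intro x
      rw [Complex.ofReal_one, one_mul, Complex.exp_ofReal_mul_I_re]
    simp_rw [e1] at h2
    rw [h2]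
    have : ((1 : ℝ) * (0 : ℝ) * Complex.I - ((1 : NNReal) : ℝ) * ((1 : ℝ) : ℂ) ^ 2 / 2 : ℂ)
        = ((-1 / 2 : ℝ) : ℂ) := by push_cast; ring
    rw [this, Complex.exp_ofReal_re]
  · refine Integrable.of_bound (C := 1) (by fun_prop) (ae_of_all _ fun x => ?_)
    rw [← Complex.ofReal_mul, Complex.norm_exp_ofReal_mul_I]

/-- Since |t| ≥ 1 - cos t, the characteristic function at 1 gives κ ≥ 1 - e^{-1/2}, so the exact
value of κ is not needed. -/
lemma quarter_le_gaussianAbsMean : 1 / 4 ≤ gaussianAbsMean := by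
  have hc : Integrable (fun t : ℝ => Real.cos t) (gaussianReal 0 1) :=
    Integrable.of_bound (C := 1) (by fun_prop) (ae_of_all _ fun x => Real.abs_cos_le_one x)
  have h : ∫ t, (1 - Real.cos t) ∂gaussianReal 0 1 ≤ gaussianAbsMean := by
    refine integral_mono ((integrable_const 1).sub hc) integrable_abs_gaussianReal fun t => ?_
    simp only
    rcases le_total |t| 2 with h2 | h2
    · have := Real.one_sub_sq_div_two_le_cos (x := t)
      nlinarith [sq_abs t, abs_nonneg t]
    · linarith [Real.neg_one_le_cos t]
  rw [integral_sub (integrable_const 1) hc, integral_cos_gaussianReal] at h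
  simp only [integral_const, probReal_univ, smul_eq_mul, mul_one] at h
  have h3 : Real.exp (-1 / 2) ≤ 3 / 4 := by
    have h4 : (4 / 3 : ℝ) ≤ Real.exp (1 / 2) := by linarith [Real.add_one_le_exp (1 / 2 : ℝ)]
    have h5 : Real.exp (-1 / 2) * Real.exp (1 / 2) = 1 := by
      rw [← Real.exp_add]; norm_num
    nlinarith [Real.exp_pos (-1 / 2 : ℝ)]
  linarith

lemma gaussianPDFReal_mul_exp_sq (t : ℝ) :
    gaussianPDFReal 0 1 t * Real.exp (1 / 4 * t ^ 2)
      = (√(2 * Real.pi))⁻¹ * Real.exp (-(1 / 4) * t ^ 2) := by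
  rw [gaussianPDFReal, mul_assoc, ← Real.exp_add]
  simp only [NNReal.coe_one, mul_one, sub_zero]
  congr 2
  ring

lemma integrable_exp_sq_gaussianReal :
    Integrable (fun t : ℝ => Real.exp (1 / 4 * t ^ 2)) (gaussianReal 0 1) := by
  rw [gaussianReal_of_var_ne_zero 0 one_ne_zero,
    integrable_withDensity_iff_integrable_smul' (measurable_gaussianPDF 0 1)
      (ae_of_all _ fun _ => gaussianPDF_lt_top)]
  simp_rw [toReal_gaussianPDF, smul_eq_mul, gaussianPDFReal_mul_exp_sq]
  exact (integrable_exp_neg_mul_sq (by norm_num)).const_mul _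

lemma integral_exp_sq_gaussianReal :
    ∫ t : ℝ, Real.exp (1 / 4 * t ^ 2) ∂gaussianReal 0 1 = √2 := by
  rw [integral_gaussianReal_eq_integral_smul one_ne_zero]
  simp_rw [smul_eq_mul, gaussianPDFReal_mul_exp_sq]
  rw [integral_const_mul, integral_gaussian, ← Real.sqrt_inv, ← Real.sqrt_mul (by positivity)]
  congr 1
  field_simp
  norm_num

lemma integrable_unitSign_mul_inner_stdGaussian (u w : E) :
    Integrable (fun x => unitSign ⟪x, u⟫ * ⟪x, w⟫) (stdGaussian E) :=
  (integrable_inner_stdGaussian w).mono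
    (Measurable.aestronglyMeasurable (by fun_prop))
    (ae_of_all _ fun x => by simp only [Real.norm_eq_abs, abs_unitSign_mul, le_refl])

/-- The reflection fixing u and negating its orthogonal complement preserves the Gaussian measure
and flips the sign of the integrand. -/
lemma integral_unitSign_mul_inner_of_orthogonal {u w : E} (huw : ⟪u, w⟫ = 0) :
    ∫ x, unitSign ⟪x, u⟫ * ⟪x, w⟫ ∂stdGaussian E = 0 := by
  let R : E ≃ₗᵢ[ℝ] E := (ℝ ∙ u).reflection
  have hu : R u = u := Submodule.reflection_mem_subspace_eq_self (Submodule.mem_span_singleton_self u)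
  have hw : R w = -w := Submodule.reflection_mem_subspace_orthogonalComplement_eq_neg
    (Submodule.mem_orthogonal_singleton_iff_inner_right.2 huw)
  have key : ∫ x, unitSign ⟪x, u⟫ * ⟪x, w⟫ ∂stdGaussian E
      = ∫ x, -(unitSign ⟪x, u⟫ * ⟪x, w⟫) ∂stdGaussian E := by
    conv_lhs => rw [← stdGaussian_map R]
    rw [integral_map (by fun_prop) (Measurable.aestronglyMeasurable (by fun_prop))]
    congr 1
    ext x
    have h1 : ⟪R x, u⟫ = ⟪x, u⟫ := by conv_lhs => rw [← hu, R.inner_map_map]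
    have h2 : ⟪R x, w⟫ = -⟪x, w⟫ := by
      have : w = R (-w) := by rw [map_neg, hw, neg_neg]
      conv_lhs => rw [this, R.inner_map_map, inner_neg_right]
    rw [h1, h2, mul_neg]
  rw [integral_neg] at key
  linarith

lemma integral_unitSign_mul_inner {u h : E} (hu : ‖u‖ = 1) :
    ∫ x, unitSign ⟪x, u⟫ * ⟪x, h⟫ ∂stdGaussian E = gaussianAbsMean * ⟪u, h⟫ := by
  set c := ⟪u, h⟫ with hc
  have ho : ⟪u, h - c • u⟫ = 0 := by
    rw [inner_sub_right, inner_smul_right, real_inner_self_eq_norm_sq, hu, ← hc]; ring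
  -- Split h along u: the parallel part yields c|⟨x,u⟩|, and the orthogonal part integrates to zero.
  have hd : ∀ x : E, unitSign ⟪x, u⟫ * ⟪x, h⟫
      = c * |⟪x, u⟫| + unitSign ⟪x, u⟫ * ⟪x, h - c • u⟫ := fun x => by
    rw [inner_sub_right, inner_smul_right, ← unitSign_mul_self]; ring
  simp_rw [hd]
  rw [integral_add ((integrable_inner_stdGaussian u).abs.const_mul c)
      (integrable_unitSign_mul_inner_stdGaussian _ _),
    integral_unitSign_mul_inner_of_orthogonal ho, integral_const_mul,
    integral_comp_inner_stdGaussian hu (f := fun t => |t|) (by fun_prop), gaussianAbsMean]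
  ring

end Gaussian

/-! ### Chernoff bounds at a fixed direction. -/

section Tails

/-- Chernoff bound for sums of a function of independent identically distributed variables. -/
lemma measureReal_sum_comp_ge_le {Ω 𝓧 : Type*} [MeasurableSpace Ω] [MeasurableSpace 𝓧]
    {P : Measure Ω} [IsProbabilityMeasure P] {ν : Measure 𝓧} {m : ℕ} {a : Fin m → Ω → 𝓧}
    (ha : ∀ i, HasLaw (a i) ν P) (hind : iIndepFun a P) {f : 𝓧 → ℝ} (hf : Measurable f)
    {t : ℝ} (ht : 0 ≤ t) (hint : Integrable (fun x => Real.exp (t * f x)) ν) (r : ℝ) :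
    P.real {ω | r ≤ ∑ i, f (a i ω)} ≤ Real.exp (-t * r) * mgf f ν t ^ m := by
  have hmeas : ∀ i, AEMeasurable (fun ω => f (a i ω)) P := fun i =>
    hf.comp_aemeasurable (ha i).aemeasurable
  have hind' : iIndepFun (fun i ω => f (a i ω)) P :=
    hind.comp₀ (fun _ => f) (fun i => (ha i).aemeasurable) (fun _ => hf.aemeasurable)
  have hint' : ∀ i, Integrable (fun ω => Real.exp (t * f (a i ω))) P := fun i => by
    rw [← (ha i).map_eq] at hint
    exact hint.comp_aemeasurable (ha i).aemeasurable
  have hm : ∀ i, mgf (fun ω => f (a i ω)) P t = mgf f ν t := fun i =>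
    (ha i).integral_comp (f := fun x => Real.exp (t * f x))
      (Measurable.aestronglyMeasurable (by fun_prop))
  have hsum := hind'.mgf_sum₀ hmeas Finset.univ (t := t)
  -- A non-integrable function has integral 0 by convention, whereas this mgf is a product of
  -- positive factors.
  have h1 : Integrable (fun ω => Real.exp (t * (∑ i, fun ω => f (a i ω)) ω)) P :=
    not_imp_comm.1 integral_undef <| by
      change mgf _ P t ≠ 0
      rw [hsum]
      exact (Finset.prod_pos fun i _ => mgf_pos (hint' i)).ne'
  have h2 := measure_ge_le_exp_mul_mgf r ht h1
  rw [hsum] at h2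
  simp_rw [hm, Finset.prod_const, Finset.card_univ, Fintype.card_fin, Finset.sum_apply] at h2
  exact h2

/-- Follows from e^y ≥ 1 + y + y²/2 and (1 - y + y²/2)(1 + y + y²/2) = 1 + y⁴/4. -/
lemma exp_neg_le_quadratic {y : ℝ} (hy : 0 ≤ y) : Real.exp (-y) ≤ 1 - y + y ^ 2 / 2 := by
  have hq : 0 < 1 + y + y ^ 2 / 2 := by positivity
  have h1 : 1 + y + y ^ 2 / 2 ≤ Real.exp y := Real.quadratic_le_exp_of_nonneg hy
  have h2 : Real.exp (-y) * Real.exp y = 1 := by rw [← Real.exp_add]; simp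
  have h3 : Real.exp (-y) * (1 + y + y ^ 2 / 2) ≤ 1 :=
    (mul_le_mul_of_nonneg_left h1 (Real.exp_pos _).le).trans h2.le
  have h4 : 1 ≤ (1 - y + y ^ 2 / 2) * (1 + y + y ^ 2 / 2) := by nlinarith [sq_nonneg (y ^ 2)]
  exact le_of_mul_le_mul_right (h3.trans h4) hq

variable {E : Type*} [NormedAddCommGroup E] [InnerProductSpace ℝ E] [FiniteDimensional ℝ E]
  [MeasurableSpace E] [BorelSpace E]

lemma integrable_orientedPart (u h : E) : Integrable (orientedPart u h) (stdGaussian E) :=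
  (integrable_inner_stdGaussian h).abs.add (integrable_unitSign_mul_inner_stdGaussian u h)

lemma integral_orientedPart {u h : E} (hu : ‖u‖ = 1) (hh : ‖h‖ = 1) :
    ∫ x, orientedPart u h x ∂stdGaussian E = gaussianAbsMean * (1 + ⟪u, h⟫) := by
  unfold orientedPart
  rw [integral_add (integrable_inner_stdGaussian h).abs
      (integrable_unitSign_mul_inner_stdGaussian u h), integral_unitSign_mul_inner hu,
    integral_comp_inner_stdGaussian hh (f := fun t => |t|) (by fun_prop), gaussianAbsMean]
  ring

lemma integrable_exp_neg_orientedPart (u h : E) {t : ℝ} (ht : 0 ≤ t) :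
    Integrable (fun x => Real.exp (t * -orientedPart u h x)) (stdGaussian E) := by
  refine Integrable.of_bound (C := 1) (Measurable.aestronglyMeasurable (by fun_prop))
    (ae_of_all _ fun x => ?_)
  rw [Real.norm_eq_abs, Real.abs_exp, Real.exp_le_one_iff]
  nlinarith [mul_nonneg ht (orientedPart_nonneg u h x)]

/-- As 0 ≤ Y ≤ 2|⟨x,h⟩|, the quadratic bound on e^{-tY} integrates to 1 - t E[Y] + 2t²;
nonnegativity makes the lower tail sub-Gaussian. -/
lemma mgf_neg_orientedPart_le {u h : E} (hu : ‖u‖ = 1) (hh : ‖h‖ = 1) {t : ℝ} (ht : 0 ≤ t) :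
    mgf (fun x => -orientedPart u h x) (stdGaussian E) t
      ≤ Real.exp (-t * (gaussianAbsMean * (1 + ⟪u, h⟫)) + 2 * t ^ 2) := by
  have hsq : Integrable (fun x : E => ⟪x, h⟫ ^ 2) (stdGaussian E) :=
    integrable_comp_inner_stdGaussian hh integrable_sq_gaussianReal
  have hsq1 : ∫ x : E, ⟪x, h⟫ ^ 2 ∂stdGaussian E = 1 := by
    rw [integral_comp_inner_stdGaussian hh (f := fun t => t ^ 2) (by fun_prop),
      integral_sq_gaussianReal]
  have hY := integrable_orientedPart u h
  have hb : mgf (fun x => -orientedPart u h x) (stdGaussian E) t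
      ≤ ∫ x, ((1 - t * orientedPart u h x) + 2 * t ^ 2 * ⟪x, h⟫ ^ 2) ∂stdGaussian E := by
    refine integral_mono (integrable_exp_neg_orientedPart u h ht)
      (((integrable_const 1).sub (hY.const_mul t)).add (hsq.const_mul _)) fun x => ?_
    have h0 := orientedPart_nonneg u h x
    have h2 := exp_neg_le_quadratic (mul_nonneg ht h0)
    have h3 : orientedPart u h x ^ 2 ≤ (2 * |⟪x, h⟫|) ^ 2 :=
      pow_le_pow_left₀ h0 (orientedPart_le u h x) 2
    rw [mul_pow, sq_abs] at h3
    simp only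
    rw [mul_neg]
    nlinarith [mul_le_mul_of_nonneg_left h3 (sq_nonneg t)]
  have hlin : Integrable (fun x => 1 - t * orientedPart u h x) (stdGaussian E) :=
    (integrable_const 1).sub (hY.const_mul t)
  rw [integral_add hlin (hsq.const_mul _), integral_sub (integrable_const 1) (hY.const_mul t), integral_const_mul, integral_const_mul,
    hsq1, integral_orientedPart hu hh] at hb
  simp only [integral_const, probReal_univ, smul_eq_mul, mul_one] at hb
  refine hb.trans ?_
  have := Real.add_one_le_exp (-t * (gaussianAbsMean * (1 + ⟪u, h⟫)) + 2 * t ^ 2)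
  linarith

variable {Ω : Type*} [MeasurableSpace Ω] {P : Measure Ω} [IsProbabilityMeasure P] {m : ℕ}
  {a : Fin m → Ω → E}

lemma measureReal_sum_orientedPart_le (ha : ∀ i, HasLaw (a i) (stdGaussian E) P)
    (hind : iIndepFun a P) {u h : E} (hu : ‖u‖ = 1) (hh : ‖h‖ = 1) {ε : ℝ} (hε : 0 ≤ ε) :
    P.real {ω | ∑ i, orientedPart u h (a i ω) ≤ m * (gaussianAbsMean * (1 + ⟪u, h⟫) - ε)}
      ≤ Real.exp (-(ε ^ 2 / 8) * m) := by
  -- t = ε/4 minimizes the exponent -tε + 2t², with value -ε²/8.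
  have ht : 0 ≤ ε / 4 := by positivity
  have key := measureReal_sum_comp_ge_le ha hind (f := fun x => -orientedPart u h x)
    (by fun_prop) ht (integrable_exp_neg_orientedPart u h ht)
    (-(m * (gaussianAbsMean * (1 + ⟪u, h⟫) - ε)))
  simp only [Finset.sum_neg_distrib, neg_le_neg_iff] at key
  refine key.trans ?_
  refine (mul_le_mul_of_nonneg_left (pow_le_pow_left₀ mgf_nonneg
    (mgf_neg_orientedPart_le hu hh ht) m) (Real.exp_pos _).le).trans ?_
  rw [← Real.exp_nat_mul, ← Real.exp_add, Real.exp_le_exp]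
  refine le_of_eq ?_
  ring

lemma measureReal_sum_sq_ge_le (ha : ∀ i, HasLaw (a i) (stdGaussian E) P)
    (hind : iIndepFun a P) {h : E} (hh : ‖h‖ = 1) :
    P.real {ω | 16 * m ≤ ∑ i, ⟪a i ω, h⟫ ^ 2} ≤ Real.exp (-3 * m) := by
  have key := measureReal_sum_comp_ge_le ha hind (f := fun x : E => ⟪x, h⟫ ^ 2)
    (by fun_prop) (t := 1 / 4) (by norm_num)
    (integrable_comp_inner_stdGaussian hh integrable_exp_sq_gaussianReal) (16 * m)
  have hm : mgf (fun x : E => ⟪x, h⟫ ^ 2) (stdGaussian E) (1 / 4) = √2 := by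
    rw [← integral_exp_sq_gaussianReal]
    exact integral_comp_inner_stdGaussian hh (f := fun t => Real.exp (1 / 4 * t ^ 2))
      (by fun_prop)
  rw [hm] at key
  have h2 : √2 ≤ Real.exp 1 := by
    have h1 := Real.add_one_le_exp 1
    have : √2 ≤ 2 := by rw [Real.sqrt_le_left] <;> norm_num
    linarith
  refine key.trans ((mul_le_mul_of_nonneg_left
    (pow_le_pow_left₀ (Real.sqrt_nonneg _) h2 m) (Real.exp_pos _).le).trans ?_)
  rw [← Real.exp_nat_mul, ← Real.exp_add, Real.exp_le_exp]
  refine le_of_eq ?_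
  ring

end Tails

/-! ### Volumetric nets of the unit sphere. -/

section Nets

open Metric Module

variable {E : Type*} [NormedAddCommGroup E] [NormedSpace ℝ E] [FiniteDimensional ℝ E]

/-- Volume bound for the size of a separated subset of the unit ball. -/
lemma card_le_of_separated_unitBall {ρ : ℝ} (hρ : 0 < ρ) (s : Finset E)
    (hs : ∀ c ∈ s, ‖c‖ ≤ 1) (hsep : ∀ c ∈ s, ∀ d ∈ s, c ≠ d → ρ ≤ ‖c - d‖) :
    (s.card : ℝ) ≤ (1 + 2 / ρ) ^ finrank ℝ E := by
  borelize E
  let μ : Measure E := Measure.addHaar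
  have hd : 0 < ρ / 2 := by positivity
  have hr : 0 < 1 + ρ / 2 := by positivity
  have hdisj : Set.Pairwise (s : Set E) (Function.onFun Disjoint fun c => ball c (ρ / 2)) := by
    intro c hc d hdd hcd
    apply ball_disjoint_ball
    rw [dist_eq_norm, add_halves]
    exact hsep c hc d hdd hcd
  have hsub : (⋃ c ∈ s, ball c (ρ / 2)) ⊆ ball (0 : E) (1 + ρ / 2) := by
    refine Set.iUnion₂_subset fun x hx => ball_subset_ball' ?_
    rw [dist_zero_right]
    linarith [hs x hx]
  have hvol : (s.card : ENNReal) * ENNReal.ofReal ((ρ / 2) ^ finrank ℝ E) * μ (ball 0 1) ≤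
      ENNReal.ofReal ((1 + ρ / 2) ^ finrank ℝ E) * μ (ball 0 1) := by
    have h := measure_mono (μ := μ) hsub
    rw [measure_biUnion_finset hdisj fun c _ => measurableSet_ball,
      μ.addHaar_ball_of_pos _ hr] at h
    simpa only [μ.addHaar_ball_of_pos _ hd, Finset.sum_const, nsmul_eq_mul, mul_assoc] using h
  have h1 := (ENNReal.mul_le_mul_iff_left (measure_ball_pos μ 0 zero_lt_one).ne'
    measure_ball_lt_top.ne).1 hvol
  have h2 := ENNReal.toReal_le_of_le_ofReal (pow_nonneg hr.le _) h1
  rw [ENNReal.toReal_mul, ENNReal.toReal_natCast, ENNReal.toReal_ofReal (by positivity)] at h2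
  have h3 : (1 + 2 / ρ) = (1 + ρ / 2) / (ρ / 2) := by field_simp; ring
  rw [h3, div_pow, le_div_iff₀ (by positivity)]
  exact h2

/-- The unit sphere has a `ρ`-net of at most `(1 + 2 / ρ) ^ dim` points. -/
lemma exists_net_unitSphere {ρ : ℝ} (hρ : 0 < ρ) :
    ∃ s : Finset E, (∀ c ∈ s, ‖c‖ = 1) ∧ (s.card : ℝ) ≤ (1 + 2 / ρ) ^ finrank ℝ E ∧
      ∀ x : E, ‖x‖ = 1 → ∃ c ∈ s, ‖x - c‖ ≤ ρ := by
  classical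
  -- A ρ-separated set of largest size, which exists by the volume bound, is a net: an uncovered
  -- point could be added to it.
  let Q : ℕ → Prop := fun k => ∃ s : Finset E, s.card = k ∧ (∀ c ∈ s, ‖c‖ = 1) ∧
    ∀ c ∈ s, ∀ d ∈ s, c ≠ d → ρ ≤ ‖c - d‖
  have hbound : ∀ k, Q k → k ≤ ⌊(1 + 2 / ρ) ^ finrank ℝ E⌋₊ := by
    rintro k ⟨s, rfl, h1, h2⟩
    exact Nat.le_floor (card_le_of_separated_unitBall hρ s (fun c hc => (h1 c hc).le) h2)
  have h0 : Q 0 := ⟨∅, by simp⟩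
  obtain ⟨s, hcard, hs, hsep⟩ := Nat.findGreatest_spec (P := Q) (Nat.zero_le _) h0
  refine ⟨s, hs, card_le_of_separated_unitBall hρ s (fun c hc => (hs c hc).le) hsep,
    fun x hx => ?_⟩
  by_contra! hfar
  have hxs : x ∉ s := fun h => by
    have := hfar x h
    rw [sub_self, norm_zero] at this
    linarith
  have hQ : Q (s.card + 1) := by
    refine ⟨insert x s, Finset.card_insert_of_notMem hxs, ?_, ?_⟩
    · intro c hc
      rcases Finset.mem_insert.1 hc with rfl | hc
      exacts [hx, hs c hc]
    · intro c hc d hd hcd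
      rcases Finset.mem_insert.1 hc with hcx | hcs <;>
        rcases Finset.mem_insert.1 hd with hdx | hds
      · exact absurd (hcx.trans hdx.symm) hcd
      · exact hcx ▸ (hfar d hds).le
      · rw [norm_sub_rev]; exact hdx ▸ (hfar c hcs).le
      · exact hsep c hcs d hds hcd
  have := Nat.le_findGreatest (hbound _ hQ) hQ
  rw [← hcard] at this
  exact absurd this (Nat.not_succ_le_self _)

end Nets

/-! ### Deterministic optimality criterion. -/

section Certificate

/-- If the objective loses against the constraints in every direction, then the planted signal is
the unique maximizer. -/
lemma isUniqueRpmMaximizer_of_forall_direction {n m : ℕ} {φ x₀ : EuclideanSpace ℝ (Fin n)}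
    {lam : ℝ} (hlam : 0 < lam) {a : Fin m → EuclideanSpace ℝ (Fin n)} {η : Fin m → ℝ}
    (H : ∀ h ≠ 0, 2 * ⟪φ, h⟫ < lam * (∑ i, orientedPart x₀ h (a i) -
      4 * ∑ i ∈ Finset.univ.filter (fun i => η i ≠ 0), |⟪a i, h⟫|)) :
    IsUniqueRpmMaximizer φ lam a (fun i => |⟪a i, x₀⟫| + η i) (x₀, fun i => -min (η i) 0) := by
  have hfeas : (x₀, fun i => -min (η i) 0) ∈ rpmFeasible a (fun i => |⟪a i, x₀⟫| + η i) := by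
    intro i
    have h1 := min_le_left (η i) 0
    have h2 := min_le_right (η i) 0
    have h3 := neg_abs_le ⟪a i, x₀⟫
    have h4 := le_abs_self ⟪a i, x₀⟫
    refine ⟨?_, ?_, ?_⟩ <;> simp only <;> linarith
  have hterm : ∀ q ∈ rpmFeasible a (fun i => |⟪a i, x₀⟫| + η i), ∀ i,
      orientedPart x₀ (q.1 - x₀) (a i) - 4 * (if η i ≠ 0 then |⟪a i, q.1 - x₀⟫| else 0)
        ≤ 2 * (q.2 i + min (η i) 0) := by
    intro q hq i
    obtain ⟨h1, h2, h3⟩ := hq i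
    have hx : ⟪a i, q.1⟫ = ⟪a i, x₀⟫ + ⟪a i, q.1 - x₀⟫ := by rw [inner_sub_right]; ring
    have hle := orientedPart_le x₀ (q.1 - x₀) (a i)
    have hdef : orientedPart x₀ (q.1 - x₀) (a i)
      = |⟪a i, q.1 - x₀⟫| + unitSign ⟪a i, x₀⟫ * ⟪a i, q.1 - x₀⟫ := rfl
    rw [hx] at h1 h2
    set v := ⟪a i, q.1 - x₀⟫
    set w := ⟪a i, x₀⟫
    have hv1 := neg_abs_le v
    have hv2 := le_abs_self v
    by_cases hη : η i = 0
    · simp only [hη, ne_eq, not_true_eq_false, if_false, mul_zero, sub_zero, min_self, add_zero]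
        at h1 h2 ⊢
      rw [hdef]
      unfold unitSign
      split_ifs with hw
      · rw [abs_of_nonneg hw] at h1 h2
        rcases abs_cases v with ⟨hv, _⟩ | ⟨hv, _⟩ <;> linarith
      · rw [abs_of_neg (not_le.1 hw)] at h1 h2
        rcases abs_cases v with ⟨hv, _⟩ | ⟨hv, _⟩ <;> linarith
    -- Here Y - 4|v| ≤ -2|v|, while feasibility gives e + η ≥ |w + v| - |w| ≥ -|v| when η < 0, and e
    -- ≥ 0 suffices when η > 0.
    · rw [if_pos hη]
      rcases le_total 0 (η i) with hs | hs
      · rw [min_eq_right hs]; linarith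
      · rw [min_eq_left hs]
        rcases abs_cases w with ⟨hw, _⟩ | ⟨hw, _⟩ <;> linarith
  have hobj : ∀ q ∈ rpmFeasible a (fun i => |⟪a i, x₀⟫| + η i),
      rpmObjective φ lam q < rpmObjective φ lam (x₀, fun i => -min (η i) 0) ∨
        q = (x₀, fun i => -min (η i) 0) := by
    intro q hq
    have hdiff : rpmObjective φ lam (x₀, fun i => -min (η i) 0) - rpmObjective φ lam q
        = lam * ∑ i, (q.2 i + min (η i) 0) - ⟪φ, q.1 - x₀⟫ := by
      unfold rpmObjective
      simp only [inner_sub_right, Finset.sum_add_distrib, Finset.sum_neg_distrib]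
      ring
    rcases eq_or_ne (q.1 - x₀) 0 with h0 | h0
    -- For x = x₀ the strict inequality is unavailable; the termwise bound says e ≥ -η⁻, and the
    -- penalty λ > 0 forces equality.
    · have hnn : ∀ i, 0 ≤ q.2 i + min (η i) 0 := fun i => by
        have := hterm q hq i
        rw [h0] at this
        simp only [orientedPart, inner_zero_right, abs_zero, mul_zero, ite_self, add_zero,
          sub_zero] at this
        linarith
      rw [h0, inner_zero_right, sub_zero] at hdiff
      rcases (Finset.sum_nonneg fun i (_ : i ∈ Finset.univ) => hnn i).eq_or_lt with hz | hpos
      · right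
        refine Prod.ext (sub_eq_zero.1 h0) (funext fun i => ?_)
        have := (Finset.sum_eq_zero_iff_of_nonneg fun i _ => hnn i).1 hz.symm i (Finset.mem_univ i)
        simp only
        linarith
      · left
        have := mul_pos hlam hpos
        linarith
    · left
      have hsum := Finset.sum_le_sum fun i (_ : i ∈ Finset.univ) => hterm q hq i
      rw [Finset.sum_sub_distrib, ← Finset.mul_sum, ← Finset.mul_sum, ← Finset.sum_filter] at hsum
      have := mul_le_mul_of_nonneg_left hsum hlam.le
      have := H _ h0
      linarith
  have hmax : IsMaxOn (rpmObjective φ lam) (rpmFeasible a (fun i => |⟪a i, x₀⟫| + η i))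
      (x₀, fun i => -min (η i) 0) := isMaxOn_iff.2 fun q hq => by
    rcases hobj q hq with h | h
    · exact h.le
    · exact le_of_eq (congrArg _ h)
  exact ⟨hfeas, hmax, fun q hq hqmax => (hobj q hq).resolve_left fun h =>
    h.not_ge (isMaxOn_iff.1 hqmax _ hfeas)⟩

end Certificate

/-! ### From the net to the whole sphere. -/

section Deterministic

variable {E : Type*} [NormedAddCommGroup E] [InnerProductSpace ℝ E] {m : ℕ} {a : Fin m → E}

/-- A bound for the quadratic form `∑ i, ⟪a i, h⟫ ^ 2` on a `1 / 2`-net of the unit sphere extends,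
up to a factor `4`, to the whole space. -/
lemma sum_sq_inner_le_of_net {s : Finset E}
    (hnet : ∀ x : E, ‖x‖ = 1 → ∃ c ∈ s, ‖x - c‖ ≤ 1 / 2) {B : ℝ} (hB : 0 ≤ B)
    (hs : ∀ c ∈ s, ∑ i, ⟪a i, c⟫ ^ 2 ≤ B ^ 2) (h : E) :
    ∑ i, ⟪a i, h⟫ ^ 2 ≤ (2 * B * ‖h‖) ^ 2 := by
  let T : E →L[ℝ] EuclideanSpace ℝ (Fin m) :=
    (PiLp.continuousLinearEquiv 2 ℝ (fun _ : Fin m => ℝ)).symm.toContinuousLinearMap ∘L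
      ContinuousLinearMap.pi fun i => innerSL ℝ (a i)
  have hT : ∀ x, ‖T x‖ ^ 2 = ∑ i, ⟪a i, x⟫ ^ 2 := fun x => by
    rw [EuclideanSpace.real_norm_sq_eq]; rfl
  have hc : ∀ c ∈ s, ‖T c‖ ≤ B := fun c hcs =>
    le_of_sq_le_sq ((hT c).trans_le (hs c hcs)) hB
  -- Self-bounding estimate: absorbing the last term gives ‖T‖ ≤ 2B.
  have hK : ‖T‖ ≤ B + ‖T‖ * (1 / 2) := by
    refine T.opNorm_le_of_unit_norm (by positivity) fun x hx => ?_
    obtain ⟨c, hcs, hxc⟩ := hnet x hx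
    have h1 : T x = T c + T (x - c) := by rw [← map_add, add_sub_cancel]
    rw [h1]
    refine (norm_add_le _ _).trans (add_le_add (hc c hcs) ((T.le_opNorm _).trans ?_))
    exact mul_le_mul_of_nonneg_left hxc (norm_nonneg _)
  rw [← hT]
  refine pow_le_pow_left₀ (norm_nonneg _) ((T.le_opNorm h).trans ?_) 2
  exact mul_le_mul_of_nonneg_right (by linarith) (norm_nonneg _)

/-- Cauchy–Schwarz on S. It serves both for the corrupted indices and, with τ = 1, for the error of
net approximation. -/
lemma sum_abs_inner_le_of_sum_sq {B : ℝ}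
    (hB : ∀ h, ∑ i, ⟪a i, h⟫ ^ 2 ≤ (B * √m * ‖h‖) ^ 2) (hB0 : 0 ≤ B) {S : Finset (Fin m)} {τ : ℝ}
    (hτ : 0 ≤ τ) (hS : (S.card : ℝ) ≤ τ ^ 2 * m) (h : E) :
    ∑ i ∈ S, |⟪a i, h⟫| ≤ B * τ * m * ‖h‖ := by
  refine le_of_sq_le_sq ?_ (by positivity)
  calc (∑ i ∈ S, |⟪a i, h⟫|) ^ 2 ≤ S.card * ∑ i ∈ S, |⟪a i, h⟫| ^ 2 := sq_sum_le_card_mul_sum_sq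
    _ ≤ (τ ^ 2 * m) * (B * √m * ‖h‖) ^ 2 := by
        refine mul_le_mul hS ?_ (Finset.sum_nonneg fun i _ => sq_nonneg _) (by positivity)
        simp_rw [sq_abs]
        exact (Finset.sum_le_univ_sum_of_nonneg fun i => sq_nonneg _).trans (hB h)
    _ = (B * τ * m * ‖h‖) ^ 2 := by
        have : √(m : ℝ) ^ 2 = m := Real.sq_sqrt (Nat.cast_nonneg m)
        calc _ = τ ^ 2 * m * (B ^ 2 * √(m : ℝ) ^ 2 * ‖h‖ ^ 2) := by ring
          _ = _ := by rw [this]; ring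

lemma orientedPart_sub_le (u h c x : E) :
    orientedPart u c x - 2 * |⟪x, h - c⟫| ≤ orientedPart u h x := by
  unfold orientedPart
  have h1 : ⟪x, c⟫ = ⟪x, h⟫ - ⟪x, h - c⟫ := by rw [inner_sub_right]; ring
  have h2 := abs_sub ⟪x, h⟫ ⟪x, h - c⟫
  have h3 := neg_abs_le (unitSign ⟪x, u⟫ * ⟪x, h - c⟫)
  rw [abs_unitSign_mul] at h3
  rw [h1, mul_sub]
  linarith

lemma orientedPart_smul_right (u h x : E) {r : ℝ} (hr : 0 ≤ r) :
    orientedPart u (r • h) x = r * orientedPart u h x := by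
  unfold orientedPart
  rw [inner_smul_right, abs_mul, abs_of_nonneg hr]
  ring

lemma orientedPart_smul_left (u h x : E) {r : ℝ} (hr : 0 < r) :
    orientedPart (r • u) h x = orientedPart u h x := by
  unfold orientedPart unitSign
  simp only [inner_smul_right, mul_nonneg_iff_of_pos_left hr]

/-- Uniform lower bound for `∑ i, orientedPart u h (a i)` on the unit sphere, robust to the removal
of few terms, deduced from bounds on a net. -/
lemma le_sum_orientedPart_of_net {s : Finset E} {ρ ε τ : ℝ} (hρ : ρ ≤ 1 / 2) (hτ : 0 ≤ τ)
    (hnet : ∀ x : E, ‖x‖ = 1 → ∃ c ∈ s, ‖x - c‖ ≤ ρ) {u : E} (hu : ‖u‖ = 1)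
    (hlow : ∀ c ∈ s, m * (gaussianAbsMean * (1 + ⟪u, c⟫) - ε) ≤ ∑ i, orientedPart u c (a i))
    (hsq : ∀ c ∈ s, ∑ i, ⟪a i, c⟫ ^ 2 ≤ 16 * m) {S : Finset (Fin m)}
    (hS : (S.card : ℝ) ≤ τ ^ 2 * m) {h : E} (hh : ‖h‖ = 1) :
    m * (gaussianAbsMean * (1 + ⟪u, h⟫) - (ε + 17 * ρ + 32 * τ))
      ≤ ∑ i, orientedPart u h (a i) - 4 * ∑ i ∈ S, |⟪a i, h⟫| := by
  have hop : ∀ x, ∑ i, ⟪a i, x⟫ ^ 2 ≤ (8 * √m * ‖x‖) ^ 2 := fun x => by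
    have := sum_sq_inner_le_of_net (a := a) (B := 4 * √m)
      (fun x hx => (hnet x hx).imp fun c hc => ⟨hc.1, hc.2.trans hρ⟩) (by positivity)
      (fun c hc => (hsq c hc).trans_eq (by
        rw [mul_pow, Real.sq_sqrt (Nat.cast_nonneg m)]; norm_num)) x
    exact this.trans_eq (by ring)
  obtain ⟨c, hcs, hhc⟩ := hnet h hh
  -- With operator norm at most 8√m, removing S costs 4·8τm = 32τm; passing from h to c costs 2·8ρm
  -- in the sum and at most ρm in the mean, hence 17ρ.
  have h1 := sum_abs_inner_le_of_sum_sq hop (by norm_num) hτ hS h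
  have h2 := sum_abs_inner_le_of_sum_sq hop (by norm_num) zero_le_one
    (S := Finset.univ) (by simp) (h - c)
  have h3 := Finset.sum_le_sum fun i (_ : i ∈ Finset.univ) => orientedPart_sub_le u h c (a i)
  rw [Finset.sum_sub_distrib, ← Finset.mul_sum] at h3
  have h4 := hlow c hcs
  have hm : (0 : ℝ) ≤ m := Nat.cast_nonneg m
  have h5 : ⟪u, h⟫ - ρ ≤ ⟪u, c⟫ := by
    have := real_inner_le_norm u (h - c)
    rw [hu, one_mul, inner_sub_right] at this
    linarith
  have hρ0 : 0 ≤ ρ := (norm_nonneg _).trans hhc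
  have h6 : gaussianAbsMean * (1 + ⟪u, h⟫) - ρ ≤ gaussianAbsMean * (1 + ⟪u, c⟫) := by
    nlinarith [gaussianAbsMean_le_one, quarter_le_gaussianAbsMean]
  have h7 := mul_le_mul_of_nonneg_left h6 hm
  have h8 := mul_le_mul_of_nonneg_left hhc hm
  rw [hh] at h1
  linarith

/-- With `ε + 17 ρ + 32 τ = 1 / (2 M)` the lower bound beats the objective in all directions. -/
lemma two_mul_inner_lt_of_sphere {M lam : ℝ} (hM : 7 ≤ M) {x₀ u φ : E} (hu : ‖u‖ = 1)
    (hxu : x₀ = ‖x₀‖ • u) (hx : 0 < ‖x₀‖) (hφ : ‖φ - x₀‖ < 1 / 2 * ‖x₀‖)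
    (hl : 7 * ‖x₀‖ ≤ lam * m) (hr : lam * m ≤ M * ‖x₀‖) (hlam : 0 < lam) {S : Finset (Fin m)}
    (H : ∀ h : E, ‖h‖ = 1 → m * (gaussianAbsMean * (1 + ⟪u, h⟫) - 1 / (2 * M))
      ≤ ∑ i, orientedPart u h (a i) - 4 * ∑ i ∈ S, |⟪a i, h⟫|) {h : E} (hh : h ≠ 0) :
    2 * ⟪φ, h⟫ < lam * (∑ i, orientedPart x₀ h (a i) - 4 * ∑ i ∈ S, |⟪a i, h⟫|) := by
  have hsphere : ∀ h : E, ‖h‖ = 1 →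
      2 * ⟪φ, h⟫ < lam * (∑ i, orientedPart x₀ h (a i) - 4 * ∑ i ∈ S, |⟪a i, h⟫|) := by
    intro h hh
    have h1 := mul_le_mul_of_nonneg_left (H h hh) hlam.le
    have h2 : ∀ x, orientedPart x₀ h x = orientedPart u h x := fun x => by
      rw [hxu, orientedPart_smul_left _ _ _ hx]
    simp_rw [h2]
    refine lt_of_lt_of_le ?_ h1
    have hin : ⟪φ, h⟫ = ‖x₀‖ * ⟪u, h⟫ + ⟪φ - x₀, h⟫ := by
      rw [inner_sub_left]
      conv_rhs => enter [2, 2]; rw [hxu]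
      rw [real_inner_smul_left]; ring
    have hD := real_inner_le_norm (φ - x₀) h
    rw [hh, mul_one] at hD
    have hc1 := (abs_le.1 (abs_real_inner_le_norm u h)).1
    have hc2 := (abs_le.1 (abs_real_inner_le_norm u h)).2
    rw [hu, hh, mul_one] at hc1 hc2
    set c := ⟪u, h⟫
    -- After division by ‖x₀‖ it remains that 2c + 1 ≤ (7/4)(1 + c) - 1/2, that is c ≤ 1; this is
    -- where 7 is used. Strictness comes from ‖φ - x₀‖ < ‖x₀‖/2.
    have hg : 1 / 4 * (1 + c) ≤ gaussianAbsMean * (1 + c) :=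
      mul_le_mul_of_nonneg_right quarter_le_gaussianAbsMean (by linarith)
    have e1 : 7 * ‖x₀‖ * (1 / 4 * (1 + c)) ≤ lam * m * (gaussianAbsMean * (1 + c)) :=
      mul_le_mul hl hg (by linarith) (le_trans (by positivity) hl)
    have e2 : lam * m * (1 / (2 * M)) ≤ ‖x₀‖ / 2 := by
      have := mul_le_mul_of_nonneg_right hr (show 0 ≤ 1 / (2 * M) by positivity)
      refine this.trans_eq ?_
      field_simp
    have e3 : ‖x₀‖ * c ≤ ‖x₀‖ := mul_le_of_le_one_right hx.le hc2
    rw [hin]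
    linarith
  have hn : 0 < ‖h‖ := norm_pos_iff.2 hh
  have key := hsphere (‖h‖⁻¹ • h) (by rw [norm_smul, norm_inv, norm_norm, inv_mul_cancel₀ hn.ne'])
  simp_rw [orientedPart_smul_right _ _ _ (inv_pos.2 hn).le, inner_smul_right, abs_mul, abs_inv,
    abs_norm, ← Finset.mul_sum] at key
  have := mul_lt_mul_of_pos_left key hn
  have e : ‖h‖ * ‖h‖⁻¹ = 1 := mul_inv_cancel₀ hn.ne'
  calc 2 * ⟪φ, h⟫ = (‖h‖ * ‖h‖⁻¹) * (2 * ⟪φ, h⟫) := by rw [e, one_mul]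
    _ = ‖h‖ * (2 * (‖h‖⁻¹ * ⟪φ, h⟫)) := by ring
    _ < _ := this
    _ = (‖h‖ * ‖h‖⁻¹) * (lam * (∑ i, orientedPart x₀ h (a i) - 4 * ∑ i ∈ S, |⟪a i, h⟫|)) := by ring
    _ = _ := by rw [e, one_mul]

end Deterministic

/-! ### Union bound over the net. -/

section Probability

open Module

variable {E : Type*} [NormedAddCommGroup E] [InnerProductSpace ℝ E] [FiniteDimensional ℝ E]
  [MeasurableSpace E] [BorelSpace E]
  {Ω : Type*} [MeasurableSpace Ω] {P : Measure Ω} [IsProbabilityMeasure P] {m : ℕ}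
  {a : Fin m → Ω → E}

/-- With overwhelming probability the pointwise bounds hold at all points of a finite set. -/
lemma exists_event_bounds_on_finset (ha : ∀ i, HasLaw (a i) (stdGaussian E) P)
    (hind : iIndepFun a P) {u : E} (hu : ‖u‖ = 1) {s : Finset E} (hs : ∀ c ∈ s, ‖c‖ = 1)
    {ε : ℝ} (hε : 0 ≤ ε) (hε1 : ε ≤ 1) :
    ∃ A : Set Ω, MeasurableSet A ∧
      1 - s.card * (2 * Real.exp (-(ε ^ 2 / 8) * m)) ≤ P.real A ∧ ∀ ω ∈ A, ∀ c ∈ s,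
        m * (gaussianAbsMean * (1 + ⟪u, c⟫) - ε) ≤ ∑ i, orientedPart u c (a i ω) ∧
        ∑ i, ⟪a i ω, c⟫ ^ 2 ≤ 16 * m := by
  let bad : E → Set Ω := fun c =>
    {ω | ∑ i, orientedPart u c (a i ω) ≤ m * (gaussianAbsMean * (1 + ⟪u, c⟫) - ε)} ∪
      {ω | 16 * m ≤ ∑ i, ⟪a i ω, c⟫ ^ 2}
  have hbad : ∀ c ∈ s, P.real (bad c) ≤ 2 * Real.exp (-(ε ^ 2 / 8) * m) := fun c hc => by
    refine (measureReal_union_le _ _).trans ?_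
    rw [two_mul]
    refine add_le_add (measureReal_sum_orientedPart_le ha hind hu (hs c hc) hε)
      ((measureReal_sum_sq_ge_le ha hind (hs c hc)).trans ?_)
    rw [Real.exp_le_exp]
    refine mul_le_mul_of_nonneg_right ?_ (Nat.cast_nonneg m)
    nlinarith
  have hunion : P.real (⋃ c ∈ s, bad c) ≤ s.card * (2 * Real.exp (-(ε ^ 2 / 8) * m)) := by
    refine (measureReal_biUnion_finset_le s bad).trans ((Finset.sum_le_sum hbad).trans_eq ?_)
    rw [Finset.sum_const, nsmul_eq_mul]
  -- The a_i are only a.e. measurable, so the bad set is replaced by a measurable hull of equal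
  -- measure.
  refine ⟨(toMeasurable P (⋃ c ∈ s, bad c))ᶜ, (measurableSet_toMeasurable _ _).compl, ?_, ?_⟩
  · rw [probReal_compl_eq_one_sub (measurableSet_toMeasurable _ _), measureReal_def,
      measure_toMeasurable, ← measureReal_def]
    linarith
  · intro ω hω c hc
    have h1 : ω ∉ bad c := fun h =>
      hω (subset_toMeasurable P _ (Set.mem_biUnion (Finset.mem_coe.2 hc) h))
    simp only [bad, Set.mem_union, Set.mem_ofPred_eq, not_or, not_le] at h1
    exact ⟨h1.1.le, h1.2.le⟩

end Probability

/-! ### Choice of constants and conclusion. -/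

theorem theorem1 (M : ℝ) (hM : 7 ≤ M) :
    ∃ c γ δ : ℝ, 0 < c ∧ 0 < γ ∧ 0 < δ ∧
      ∀ (n m : ℕ) (x₀ φ : EuclideanSpace ℝ (Fin n)) (lam : ℝ)
        (Ω : Type*) [MeasurableSpace Ω] (P : Measure Ω) [IsProbabilityMeasure P]
        (a : Fin m → Ω → EuclideanSpace ℝ (Fin n)),
        ‖φ - x₀‖ < 0.5 * ‖x₀‖ →
        (∀ i, HasLaw (a i) (stdGaussian (EuclideanSpace ℝ (Fin n))) P) →
        iIndepFun a P →
        c * n ≤ m →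
        lam ∈ Set.Icc (7 / m * ‖x₀‖) (M / m * ‖x₀‖) →
        ∃ E : Set Ω, MeasurableSet E ∧
          1 - 9 * m * Real.exp (-γ * m) ≤ P.real E ∧
          ∀ ω ∈ E, ∀ η : Fin m → ℝ,
            ((Finset.univ.filter fun i => η i ≠ 0).card : ℝ) ≤ δ * m →
            IsUniqueRpmMaximizer φ lam (fun i => a i ω)
              (fun i => |⟪a i ω, x₀⟫| + η i) (x₀, fun i => -min (η i) 0) := by
  have hM0 : 0 < M := by linarith
  -- The error budget 1/(2M) is split as ε = 17ρ = 1/(8M) and 32τ = 1/(4M).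
  set ε : ℝ := 1 / (8 * M) with hε
  set ρ : ℝ := 1 / (136 * M) with hρ
  set τ : ℝ := 1 / (128 * M) with hτ
  have hε0 : 0 < ε := by positivity
  have hρ0 : 0 < ρ := by positivity
  have hτ0 : 0 < τ := by positivity
  have hε1 : ε ≤ 1 := by rw [hε, div_le_one (by positivity)]; linarith
  have hρ1 : ρ ≤ 1 / 2 := by
    rw [hρ]; exact one_div_le_one_div_of_le (by norm_num) (by linarith)
  have hsum : ε + 17 * ρ + 32 * τ = 1 / (2 * M) := by
    rw [hε, hρ, hτ]; field_simp; norm_num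
  have hlog : 0 < Real.log (1 + 2 / ρ) := Real.log_pos (by simpa using hρ0)
  refine ⟨16 * Real.log (1 + 2 / ρ) / ε ^ 2, ε ^ 2 / 16, τ ^ 2, by positivity, by positivity,
    by positivity, ?_⟩
  intro n m x₀ φ lam Ω _ P _ a hφ ha hind hmn hlam
  have hx : 0 < ‖x₀‖ := by
    have := (norm_nonneg _).trans_lt hφ
    linarith
  have hn : 0 < n := by
    rcases Nat.eq_zero_or_pos n with rfl | h
    · rw [Subsingleton.elim x₀ 0, norm_zero] at hx
      exact absurd hx (lt_irrefl _)
    · exact h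
  have hm : (0 : ℝ) < m := lt_of_lt_of_le (by positivity) hmn
  have hm1 : (1 : ℝ) ≤ m := by exact_mod_cast Nat.cast_pos.1 hm
  have hu : ‖‖x₀‖⁻¹ • x₀‖ = 1 := by
    rw [norm_smul, norm_inv, norm_norm, inv_mul_cancel₀ hx.ne']
  have hxu : x₀ = ‖x₀‖ • (‖x₀‖⁻¹ • x₀) := by rw [smul_smul, mul_inv_cancel₀ hx.ne', one_smul]
  have hl : 7 * ‖x₀‖ ≤ lam * m := by
    have := mul_le_mul_of_nonneg_right hlam.1 hm.le
    field_simp at this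
    linarith
  have hr : lam * m ≤ M * ‖x₀‖ := by
    have := mul_le_mul_of_nonneg_right hlam.2 hm.le
    field_simp at this
    linarith
  have hlam0 : 0 < lam := lt_of_lt_of_le (by positivity) hlam.1
  obtain ⟨s, hs1, hscard, hsnet⟩ := exists_net_unitSphere (E := EuclideanSpace ℝ (Fin n)) hρ0
  obtain ⟨A, hA, hPA, hAω⟩ := exists_event_bounds_on_finset ha hind hu hs1 hε0.le hε1
  refine ⟨A, hA, le_trans ?_ hPA, ?_⟩
  -- The constant c makes the net consume half of the Chernoff exponent ε²/8, leaving γ = ε²/16.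
  · have hcard : (s.card : ℝ) ≤ Real.exp (ε ^ 2 / 16 * m) := by
      refine hscard.trans ?_
      rw [finrank_euclideanSpace_fin, ← Real.exp_log (show 0 < 1 + 2 / ρ by positivity),
        ← Real.exp_nat_mul, Real.exp_le_exp]
      rw [div_mul_eq_mul_div, div_le_iff₀ (by positivity)] at hmn
      linarith
    have hexp : Real.exp (ε ^ 2 / 16 * m) * Real.exp (-(ε ^ 2 / 8) * m)
        = Real.exp (-(ε ^ 2 / 16) * m) := by
      rw [← Real.exp_add]; congr 1; ring
    have h1 := mul_le_mul_of_nonneg_right hcard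
      (show 0 ≤ 2 * Real.exp (-(ε ^ 2 / 8) * m) by positivity)
    have h2 : Real.exp (-(ε ^ 2 / 16) * m) ≤ m * Real.exp (-(ε ^ 2 / 16) * m) :=
      le_mul_of_one_le_left (Real.exp_pos _).le hm1
    have h3 := Real.exp_pos (-(ε ^ 2 / 16) * m)
    nlinarith
  · intro ω hω η hη
    refine isUniqueRpmMaximizer_of_forall_direction hlam0 fun h hh =>
      two_mul_inner_lt_of_sphere hM hu hxu hx (by linarith) hl hr hlam0 (fun h hh => ?_) hh
    have := le_sum_orientedPart_of_net hρ1 hτ0.le hsnet hu (fun c hc => (hAω ω hω c hc).1)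
      (fun c hc => (hAω ω hω c hc).2) hη hh
    rwa [hsum] at this
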